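/- Let $n\ge 1$ and let $G=SO(2n+1)$ (the classical model of the compact connected simple Lie group of type $B_n$) with Haar probability measure $m_G$. Let $T_n\subset G$ be the maximal torus of block diagonal matrices with $n$ blocks $\begin{pmatrix}\cos\theta_j&-\sin\theta_j\\ \sin\theta_j&\cos\theta_j\end{pmatrix}$ followed by a final $1\times1$ block $1$; identify such an element with the vector $(e^{i\theta_1},\dots,e^{i\theta_n})$. For $x\in T_n$ let $\mu_x$ be the orbital measure on the conjugacy class of $x$, $\int_G f\,d\mu_x=\int_G f(gxg^{-1})\,dm_G(g)$ for continuous $f$. Call $(x_1,\dots,x_L)\in T_n^L$ absolutely continuous if $\mu_{x_1}*\cdots*\mu_{x_L}$ is absolutely continuous with respect to $m_G$. For $x\in T_n$ let $u$ be the number of entries of its vector equal to $1$, $v$ the number of entries equal to $-1$, and $s$ the maximum over $0<a<\pi$ of the number of entries in $\{e^{ia},e^{-ia}\}$. Then $x$ is of exactly one dominant type: - type $B$ if $u>v$ and $2u+1>s$, and then $S_x=2u+1$; - type $D$ if $v>u$ and $2v>s$, and then $S_x=2v$; - type $BD$ if $u=v$ and $2v\ge s$, and then $S_x^{(1)}=2u+1$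 and $S_x^{(2)}=2v$; - type $S$ if $s\ge 2u+1$ and $s\ge 2v$, and then $S_x=s$. The parity $p$ of $(x_1,\dots,x_L)$ is $1$ if an odd number of the $x_j$ are of dominant type $D$, and $2$ otherwise. The tuple is eligible if one of the following holds: (i) at least two of the $x_j$ are of dominant type $BD$ or $S$; (ii) exactly one $x_j$ is of dominant type $S$, none is of dominant type $BD$, and $\sum_{i=1}^L S_{x_i}\le(2n+1)(L-1)$; (iii) exactly one $x_j$ is of dominant type $BD$, none is of dominant type $S$, and $S_{x_j}^{(p)}+\sum_{i\ne j}S_{x_i}\le(2n+1)(L-1)$; (iv) no $x_j$ is of dominant type $BD$ or $S$, and $\sum_{i=1}^L S_{x_i}\le(2n+1)(L-1)+p-1$. **Proposition.** Every absolutely continuous tuple $(x_1,\dots,x_L)\in T_n^L$ is eligible. -/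

import Mathlib

open MeasureTheory

noncomputable section

/-! ### The group `SO(2n+1)` with its normalised Haar measure -/

/-- The index set of the `2n+1` coordinates: `n` pairs of coordinates `(0, j), (1, j)`, one pair
for each `2 × 2` block, and one final coordinate. -/
abbrev CoordIdx (n : ℕ) : Type := (Fin 2 × Fin n) ⊕ Unit

/-- `CoordIdx n` has `2n+1` elements. -/
theorem card_coordIdx (n : ℕ) : Fintype.card (CoordIdx n) = 2 * n + 1 := by
  simp [CoordIdx]

/-- The compact Lie group of type `B_n`: real orthogonal matrices of size `2n+1`, determinant `1`. -/
abbrev SOdd (n : ℕ) : Type := Matrix.specialOrthogonalGroup (CoordIdx n) ℝ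

namespace SOdd

variable {n : ℕ}

theorem transpose_mul_self (g : SOdd n) :
    (g : Matrix (CoordIdx n) (CoordIdx n) ℝ).transpose *
      (g : Matrix (CoordIdx n) (CoordIdx n) ℝ) = 1 :=
  g.2.1.1

theorem coe_inv (g : SOdd n) :
    ((g⁻¹ : SOdd n) : Matrix (CoordIdx n) (CoordIdx n) ℝ) =
      (g : Matrix (CoordIdx n) (CoordIdx n) ℝ).transpose := rfl

instance : IsTopologicalGroup (SOdd n) where
  continuous_inv := by
    refine Continuous.subtype_mk ?_ _
    exact continuous_subtype_val.matrix_transpose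

theorem mem_iff (A : Matrix (CoordIdx n) (CoordIdx n) ℝ) :
    A ∈ Matrix.specialOrthogonalGroup (CoordIdx n) ℝ ↔ A.transpose * A = 1 ∧ A.det = 1 := by
  rw [Matrix.mem_specialOrthogonalGroup_iff, Matrix.mem_orthogonalGroup_iff']

theorem abs_entry_le_one {A : Matrix (CoordIdx n) (CoordIdx n) ℝ} (hA : A.transpose * A = 1)
    (i j : CoordIdx n) : A i j ∈ Set.Icc (-1 : ℝ) 1 := by
  have h : ∑ k, A k j * A k j = 1 := by
    have := congrFun (congrFun hA j) j
    simpa [Matrix.mul_apply] using this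
  have h2 : A i j * A i j ≤ ∑ k, A k j * A k j :=
    Finset.single_le_sum (f := fun k => A k j * A k j) (fun k _ => mul_self_nonneg _)
      (Finset.mem_univ i)
  constructor <;> nlinarith

instance : CompactSpace (SOdd n) := by
  refine isCompact_iff_compactSpace.mp ?_
  have hbox : IsCompact (X := Matrix (CoordIdx n) (CoordIdx n) ℝ)
      (Set.univ.pi fun _ => Set.univ.pi fun _ => Set.Icc (-1 : ℝ) 1) :=
    isCompact_univ_pi (X := fun _ : CoordIdx n => CoordIdx n → ℝ)
      fun _ => isCompact_univ_pi fun _ => isCompact_Icc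
  refine hbox.of_isClosed_subset ?_ ?_
  · have : (Matrix.specialOrthogonalGroup (CoordIdx n) ℝ :
        Set (Matrix (CoordIdx n) (CoordIdx n) ℝ)) =
        {A | A.transpose * A = 1} ∩ {A | A.det = 1} := by
      ext A
      exact mem_iff A
    rw [this]
    refine IsClosed.inter (isClosed_eq ?_ continuous_const) (isClosed_eq ?_ continuous_const)
    · exact continuous_id.matrix_transpose.matrix_mul continuous_id
    · exact continuous_id.matrix_det
  · intro A hA i _ j _
    exact abs_entry_le_one ((mem_iff A).1 hA).1 i j

instance : SecondCountableTopology (SOdd n) := by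
  have : SecondCountableTopology (Matrix (CoordIdx n) (CoordIdx n) ℝ) :=
    inferInstanceAs (SecondCountableTopology (CoordIdx n → CoordIdx n → ℝ))
  exact TopologicalSpace.Subtype.secondCountableTopology _

instance : MeasurableSpace (SOdd n) := borel _

instance : BorelSpace (SOdd n) := ⟨rfl⟩

/-- The Haar probability measure `m_G` of `G = SO(2n+1)`. -/
def haar (n : ℕ) : Measure (SOdd n) := Measure.haarMeasure ⊤

instance : IsProbabilityMeasure (haar n) :=
  ⟨by
    have h := Measure.haarMeasure_self (K₀ := (⊤ : TopologicalSpace.PositiveCompacts (SOdd n)))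
    simpa [haar] using h⟩

end SOdd

/-! ### The maximal torus -/

/-- The maximal torus `T_n`: the element with parameters `(e^{iθ_1}, …, e^{iθ_n})` is identified
with that vector. -/
abbrev TorusB (n : ℕ) : Type := Fin n → Circle

namespace TorusB

variable {n : ℕ}

/-- The `2 × 2` block `[[cos θ, -sin θ], [sin θ, cos θ]]` for `z = e^{iθ}`. -/
def rotBlock (z : Circle) : Matrix (Fin 2) (Fin 2) ℝ :=
  !![(z : ℂ).re, -(z : ℂ).im; (z : ℂ).im, (z : ℂ).re]

theorem rotBlock_exp (θ : ℝ) :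
    rotBlock (Circle.exp θ) = !![Real.cos θ, -Real.sin θ; Real.sin θ, Real.cos θ] := by
  simp [rotBlock, Circle.coe_exp, Complex.exp_ofReal_mul_I_re, Complex.exp_ofReal_mul_I_im]

theorem re_sq_add_im_sq (z : Circle) : (z : ℂ).re * (z : ℂ).re + (z : ℂ).im * (z : ℂ).im = 1 := by
  have := Circle.normSq_coe z
  rwa [Complex.normSq_apply] at this

theorem rotBlock_transpose_mul (z : Circle) : (rotBlock z).transpose * rotBlock z = 1 := by
  have h := re_sq_add_im_sq z
  ext i j
  fin_cases i <;> fin_cases j <;> simp [rotBlock, Matrix.mul_apply, Fin.sum_univ_two] <;> linarith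

theorem rotBlock_det (z : Circle) : (rotBlock z).det = 1 := by
  have h := re_sq_add_im_sq z
  simp [rotBlock, Matrix.det_fin_two]
  linarith

/-- The block diagonal matrix with blocks `rotBlock (x j)` and a final `1 × 1` block `1`. -/
def toMatrix (x : TorusB n) : Matrix (CoordIdx n) (CoordIdx n) ℝ :=
  Matrix.fromBlocks (Matrix.blockDiagonal fun j => rotBlock (x j)) 0 0 1

/-- The torus element as an element of `SO(2n+1)`. -/
def toSO (x : TorusB n) : SOdd n :=
  ⟨toMatrix x, by
    rw [SOdd.mem_iff]
    constructor
    · rw [toMatrix, Matrix.fromBlocks_transpose, Matrix.fromBlocks_multiply,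
        Matrix.blockDiagonal_transpose, ← Matrix.blockDiagonal_mul]
      simp only [rotBlock_transpose_mul]
      have h : (Matrix.blockDiagonal fun _ : Fin n => (1 : Matrix (Fin 2) (Fin 2) ℝ)) = 1 :=
        Matrix.blockDiagonal_one
      simp [h]
    · rw [toMatrix, Matrix.det_fromBlocks_zero₂₁, Matrix.det_blockDiagonal]
      simp [rotBlock_det]⟩

/-! ### Orbital measures -/

/-- The orbital measure `μ_x`: the image of `m_G` under `g ↦ g x g⁻¹`, that is
`∫ f dμ_x = ∫ f (g x g⁻¹) dm_G(g)`. -/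
def orbitalMeasure (x : TorusB n) : Measure (SOdd n) :=
  (SOdd.haar n).map fun g => g * x.toSO * g⁻¹

/-- The convolution `μ_{x_1} * ⋯ * μ_{x_L}` (the unit mass at the identity when `L = 0`). -/
def convOrbital {L : ℕ} (x : Fin L → TorusB n) : Measure (SOdd n) :=
  (List.ofFn fun i => (x i).orbitalMeasure).foldr Measure.mconv (Measure.dirac 1)

/-- The tuple `(x_1, …, x_L)` is absolutely continuous. -/
def IsAbsCont {L : ℕ} (x : Fin L → TorusB n) : Prop :=
  convOrbital x ≪ SOdd.haar n

/-! ### Type and dominant type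

An element `x` of the torus is conjugate in `SO(2n+1)` to one whose vector has `u` entries `1`,
`v` entries `-1`, and `s_ℓ` entries `e^{i a_ℓ}` with distinct `0 < a_ℓ < π`. The conjugations
permute the entries of the vector and replace some of them by their inverses, so that `u`, `v` and
the `s_ℓ` are the numbers below. -/

/-- `u`: the number of entries equal to `1`. -/
def u (x : TorusB n) : ℕ := Nat.card {j // x j = 1}

/-- `v`: the number of entries equal to `-1`. -/
def v (x : TorusB n) : ℕ := Nat.card {j // (x j : ℂ) = -1}

/-- The number of entries equal to `z` or to `z⁻¹` (that is, `s_ℓ` for `z = e^{± i a_ℓ}`). -/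
def mult (x : TorusB n) (z : Circle) : ℕ := Nat.card {j // x j = z ∨ x j = z⁻¹}

open Classical in
/-- `s = max s_ℓ`, which is `0` when all entries are `± 1`. -/
def s (x : TorusB n) : ℕ :=
  (Finset.univ.filter fun j => x j ≠ 1 ∧ (x j : ℂ) ≠ -1).sup fun j => x.mult (x j)

end TorusB

/-- The four dominant types. -/
inductive DominantType : Type
  | B
  | D
  | BD
  | S

namespace TorusB

variable {n : ℕ}

/-- The criterion for `x` to be of a given dominant type. -/
def HasDominantType (x : TorusB n) : DominantType → Prop
  | .B => x.v < x.u ∧ x.s < 2 * x.u + 1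
  | .D => x.u < x.v ∧ x.s < 2 * x.v
  | .BD => x.v = x.u ∧ x.s ≤ 2 * x.v
  | .S => 2 * x.u + 1 ≤ x.s ∧ 2 * x.v ≤ x.s

/-- Each `x` satisfies precisely one of the four criteria. -/
theorem existsUnique_hasDominantType (x : TorusB n) : ∃! t, x.HasDominantType t := by
  have key : ∀ t t', x.HasDominantType t → x.HasDominantType t' → t = t' := by
    intro t t' h h'
    cases t <;> cases t' <;> simp only [HasDominantType] at h h' <;> first | rfl | omega
  by_cases hS : 2 * x.u + 1 ≤ x.s ∧ 2 * x.v ≤ x.s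
  · exact ⟨.S, hS, fun t ht => key _ _ ht hS⟩
  · rcases lt_trichotomy x.u x.v with h | h | h
    · have hD : x.HasDominantType .D := ⟨h, by omega⟩
      exact ⟨.D, hD, fun t ht => key _ _ ht hD⟩
    · have hBD : x.HasDominantType .BD := ⟨h.symm, by omega⟩
      exact ⟨.BD, hBD, fun t ht => key _ _ ht hBD⟩
    · have hB : x.HasDominantType .B := ⟨h, by omega⟩
      exact ⟨.B, hB, fun t ht => key _ _ ht hB⟩

/-- The dominant type of `x`. -/
def dominantType (x : TorusB n) : DominantType := x.existsUnique_hasDominantType.choose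

theorem dominantType_eq_iff (x : TorusB n) (t : DominantType) :
    x.dominantType = t ↔ x.HasDominantType t :=
  ⟨fun h => h ▸ x.existsUnique_hasDominantType.choose_spec.1,
    fun h => (x.existsUnique_hasDominantType.choose_spec.2 t h).symm⟩

/-- `S_x` for `x` of dominant type `B`, `D` or `S`, and `S_x^{(p)}` for `x` of dominant type `BD`,
where `S_x^{(1)} = 2u+1` and `S_x^{(2)} = 2v`. -/
def bigS (p : ℕ) (x : TorusB n) : ℕ :=
  match x.dominantType with
  | .B => 2 * x.u + 1
  | .D => 2 * x.v
  | .S => x.s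
  | .BD => if p = 1 then 2 * x.u + 1 else 2 * x.v

open Classical in
/-- The parity of a tuple: `1` if an odd number of the `x_j` are of dominant type `D`, else `2`. -/
def parity {L : ℕ} (x : Fin L → TorusB n) : ℕ :=
  if Odd (Nat.card {j // (x j).dominantType = .D}) then 1 else 2

/-- Eligibility of a tuple; the four disjuncts are exclusive. The inequalities are read in `ℤ`. -/
def Eligible {L : ℕ} (x : Fin L → TorusB n) : Prop :=
  -- at least two of the `x_j` are of dominant type `BD` or `S`
  (∃ i j, i ≠ j ∧ ((x i).dominantType = .BD ∨ (x i).dominantType = .S) ∧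
    ((x j).dominantType = .BD ∨ (x j).dominantType = .S)) ∨
  -- exactly one is of dominant type `S`, none of dominant type `BD`
  ((∃! j, (x j).dominantType = .S) ∧ (∀ j, (x j).dominantType ≠ .BD) ∧
    (∑ j, ((x j).bigS (parity x) : ℤ)) ≤ (2 * n + 1) * ((L : ℤ) - 1)) ∨
  -- exactly one is of dominant type `BD`, none of dominant type `S`
  ((∃! j, (x j).dominantType = .BD) ∧ (∀ j, (x j).dominantType ≠ .S) ∧
    (∑ j, ((x j).bigS (parity x) : ℤ)) ≤ (2 * n + 1) * ((L : ℤ) - 1)) ∨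
  -- none is of dominant type `BD` or `S`
  ((∀ j, (x j).dominantType ≠ .BD ∧ (x j).dominantType ≠ .S) ∧
    (∑ j, ((x j).bigS (parity x) : ℤ)) ≤ (2 * n + 1) * ((L : ℤ) - 1) + parity x - 1)

end TorusB

end

/-! Choose for each `x i` an eigenvalue `α i` whose complex eigenspace has dimension at least the
number `S` of `x i`: `1` for type `B`, `-1` for type `D`, a non-real `e^{ia}` for type `S`, and `1`
or `-1` according to the parity for type `BD`. Conjugation preserves these dimensions, and on the
intersection of the eigenspaces a product of conjugates acts as `∏ α i`. Hence the convolution is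
carried by elements having the eigenvalue `∏ α i` with multiplicity at least `∑ S - (2n+1)(L-1)`
(`exists_isCompact_convOrbital`).

Haar-almost every element of `SO(2n+1)` has `1` as an eigenvalue of multiplicity at most one and
avoids any other prescribed eigenvalue. Absolute continuity therefore forces `∑ S ≤ (2n+1)(L-1)` if
`∏ α i ≠ 1`, with one more unit allowed if `∏ α i = 1`. Without types `BD` and `S` the product is
the sign given by the parity, which explains the term `p - 1`; with exactly one such entry the
product is never `1`.

Genericity rests on `haar_zeros_eq_zero`: a function that is analytic along curves and not
identically zero has a null zero set. Analytic curves come from pairs of reflections, which generate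
the group, and Fubini spreads vanishing from the zero set to the whole group. -/

noncomputable section

open scoped Matrix

/-! ### Householder reflections -/

section Householder

variable {m : Type*} [Fintype m] [DecidableEq m]

/-- The matrix of the reflection in the hyperplane orthogonal to `w` (the identity if `w = 0`). -/
def householder (w : m → ℝ) : Matrix m m ℝ :=
  1 - (2 / (w ⬝ᵥ w)) • Matrix.vecMulVec w w

theorem householder_apply (w : m → ℝ) (i j : m) :
    householder w i j = (1 : Matrix m m ℝ) i j - 2 / (w ⬝ᵥ w) * (w i * w j) := by
  simp [householder, Matrix.vecMulVec_apply]

theorem householder_transpose (w : m → ℝ) : (householder w).transpose = householder w := by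
  ext i j
  simp only [Matrix.transpose_apply, householder_apply, Matrix.one_apply, eq_comm (a := j)]
  ring

theorem householder_mulVec (w x : m → ℝ) :
    householder w *ᵥ x = x - (2 * (w ⬝ᵥ x) / (w ⬝ᵥ w)) • w := by
  rw [householder, Matrix.sub_mulVec, Matrix.one_mulVec, Matrix.smul_mulVec,
    Matrix.vecMulVec_mulVec]
  ext i
  simp
  ring

theorem householder_zero : householder (0 : m → ℝ) = 1 := by
  simp [householder]

theorem householder_mul_self (w : m → ℝ) : householder w * householder w = 1 := by
  by_cases hw : w = 0
  · simp [hw, householder_zero]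
  have h : w ⬝ᵥ w ≠ 0 := fun h => hw (dotProduct_self_eq_zero.1 h)
  refine Matrix.toLin'.injective (LinearMap.ext fun x => ?_)
  rw [Matrix.toLin'_apply, Matrix.toLin'_apply, ← Matrix.mulVec_mulVec, householder_mulVec w x,
    householder_mulVec, dotProduct_sub, dotProduct_smul, Matrix.one_mulVec, smul_eq_mul]
  ext i
  simp
  field_simp
  ring

/-- A rank-one update of the identity: the determinant is `1 - 2`. -/
theorem det_householder {w : m → ℝ} (hw : w ≠ 0) : (householder w).det = -1 := by
  have h : w ⬝ᵥ w ≠ 0 := fun h => hw (dotProduct_self_eq_zero.1 h)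
  have h1 : householder w = 1 + Matrix.replicateCol Unit ((-(2 / (w ⬝ᵥ w))) • w) *
      Matrix.replicateRow Unit w := by
    ext i j
    simp [householder_apply, Matrix.mul_apply]
    ring
  rw [h1, Matrix.det_one_add_replicateCol_mul_replicateRow, dotProduct_smul, smul_eq_mul]
  field_simp
  ring

/-- Cartan–Dieudonné for real orthogonal matrices. -/
theorem exists_list_householder (M : Matrix m m ℝ) (hM : M.transpose * M = 1) :
    ∃ l : List (m → ℝ), (∀ w ∈ l, w ≠ 0) ∧ M = (l.map householder).prod := by
  suffices ∃ l : List (m → ℝ), M = (l.map householder).prod by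
    obtain ⟨l, rfl⟩ := this
    -- Zero vectors contribute the identity, so they can be dropped.
    refine ⟨l.filter (· ≠ 0), fun w hw => by simpa using (List.mem_filter.1 hw).2, ?_⟩
    clear hM
    induction l with
    | nil => rfl
    | cons a l ih =>
      by_cases ha : a = 0
      · simpa [ha, householder_zero] using ih
      · simp only [List.map_cons, List.prod_cons, ih]
        rw [List.filter_cons_of_pos (by simpa using ha), List.map_cons, List.prod_cons]
  let f : EuclideanSpace ℝ m →ₗ[ℝ] EuclideanSpace ℝ m := Matrix.toEuclideanLin M
  have hf : ∀ x y, inner ℝ (f x) (f y) = inner ℝ x y := by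
    intro x y
    simp only [f, EuclideanSpace.inner_eq_star_dotProduct, Matrix.toLpLin_apply, star_trivial]
    rw [Matrix.dotProduct_mulVec, ← Matrix.mulVec_transpose, Matrix.mulVec_mulVec, hM,
      Matrix.one_mulVec]
  let φ := (f.isometryOfInner hf).toLinearIsometryEquiv rfl
  obtain ⟨l, -, hl⟩ := φ.reflections_generate_dim
  have hφ : ∀ x, φ x = WithLp.toLp 2 (M *ᵥ x.ofLp) := fun x => rfl
  have key : ∀ (l : List (EuclideanSpace ℝ m)) (x : EuclideanSpace ℝ m),
      (l.map fun v => (Submodule.span ℝ {v})ᗮ.reflection).prod x =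
        WithLp.toLp 2 (((l.map fun v => v.ofLp).map householder).prod *ᵥ x.ofLp) := by
    intro l x
    induction l with
    | nil => simp
    | cons a l ih =>
      simp only [List.map_cons, List.prod_cons, ← Matrix.mulVec_mulVec]
      have hn : ‖a‖ ^ 2 = a.ofLp ⬝ᵥ a.ofLp := by
        rw [← real_inner_self_eq_norm_sq, EuclideanSpace.inner_eq_star_dotProduct, star_trivial]
      rw [LinearIsometryEquiv.coe_mul, Function.comp_apply, ih,
        Submodule.reflection_orthogonal_apply, Submodule.reflection_singleton_apply, householder_mulVec]
      ext i
      simp [EuclideanSpace.inner_eq_star_dotProduct, hn, dotProduct_comm]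
      ring
  refine ⟨l.map fun v => v.ofLp, Matrix.toLin'.injective (LinearMap.ext fun x => ?_)⟩
  have := hφ (WithLp.toLp 2 x)
  rw [hl, key] at this
  simpa using (congrArg WithLp.ofLp this).symm

end Householder

/-! ### Zero sets of analytic functions on `SO(2n+1)` -/

/-- `f` is analytic along every analytic curve of matrices. -/
def AnalyticAlongCurves {m : Type*} (f : Matrix m m ℝ → ℂ) : Prop :=
  ∀ M : ℝ → Matrix m m ℝ, (∀ i j, AnalyticOnNhd ℝ (fun t => M t i j) Set.univ) →
    AnalyticOnNhd ℝ (fun t => f (M t)) Set.univ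

/-- By the identity theorem the zeros form a discrete closed set, which is Lebesgue-null. -/
theorem AnalyticOnNhd.ae_ne_zero {f : ℝ → ℂ} (hf : AnalyticOnNhd ℝ f Set.univ) {t : ℝ}
    (ht : f t ≠ 0) : ∀ᵐ s, f s ≠ 0 := by
  have h := hf.preimage_zero_mem_codiscrete ht
  have h2 := ae_restrict_le_codiscreteWithin (μ := (volume : Measure ℝ)) MeasurableSet.univ h
  rw [Measure.restrict_univ] at h2
  filter_upwards [h2] with s hs using by simpa using hs

namespace SOdd

variable {n : ℕ}

instance : (haar n).IsMulLeftInvariant := by unfold haar; infer_instance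

instance : (haar n).IsOpenPosMeasure := by unfold haar; infer_instance

/-- If a closed set `A` meets each `t ↦ c t * g` in a null set or contains it, then almost every
`g ∈ A` has `c t * g ∈ A` for all `t`. -/
theorem ae_forall_curve_mul_mem {A : Set (SOdd n)} (hA : IsClosed A) {c : ℝ → SOdd n}
    (hc : Continuous c) (h0 : c 0 = 1)
    (h : ∀ g, (∀ t, c t * g ∈ A) ∨ ∀ᵐ t, c t * g ∉ A) :
    ∀ᵐ g ∂(haar n), g ∈ A → ∀ t, c t * g ∈ A := by
  set A' : Set (SOdd n) := {g | ∀ t, c t * g ∈ A} with hA'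
  have hA'c : IsClosed A' := by
    rw [hA', Set.ofPred_forall]
    exact isClosed_iInter fun t => hA.preimage (continuous_const.mul continuous_id)
  have hsub : A' ⊆ A := fun g hg => by simpa [h0] using hg 0
  -- The set of `(t, g)` with `c t * g ∈ A` is measured in two ways. Slices at fixed `t` have
  -- measure `haar n A` by left invariance; slices at fixed `g` are full or null, which gives `haar
  -- n A'`.
  let lam : Measure ℝ := volume.restrict (Set.Icc 0 1)
  have hmeas : MeasurableSet {p : ℝ × SOdd n | c p.1 * p.2 ∈ A} :=
    (hA.preimage ((hc.comp continuous_fst).mul continuous_snd)).measurableSet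
  have e1 : (lam.prod (haar n)) {p : ℝ × SOdd n | c p.1 * p.2 ∈ A} = haar n A := by
    rw [Measure.prod_apply hmeas]
    have : ∀ t, haar n (Prod.mk t ⁻¹' {p : ℝ × SOdd n | c p.1 * p.2 ∈ A}) = haar n A := fun t =>
      measure_preimage_mul (haar n) (c t) A
    rw [lintegral_congr this]
    simp [lam]
  have e2 : (lam.prod (haar n)) {p : ℝ × SOdd n | c p.1 * p.2 ∈ A} = haar n A' := by
    rw [Measure.prod_apply_symm hmeas, ← lintegral_indicator_one hA'c.measurableSet]
    refine lintegral_congr fun g => ?_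
    by_cases hg : g ∈ A'
    · have : ((fun t => (t, g)) ⁻¹' {p : ℝ × SOdd n | c p.1 * p.2 ∈ A}) = Set.univ :=
        Set.eq_univ_of_forall hg
      simp [this, hg, lam]
    · have h2 := ae_restrict_of_ae (s := Set.Icc (0 : ℝ) 1) ((h g).resolve_left hg)
      rw [Set.indicator_of_notMem hg]
      rw [ae_iff] at h2
      simp only [not_not] at h2
      exact h2
  have e3 : haar n (A \ A') = 0 := by
    rw [measure_sdiff hsub hA'c.measurableSet.nullMeasurableSet (measure_ne_top _ _), ← e1, e2,
      tsub_self]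
  rw [ae_iff]
  refine measure_mono_null (fun g hg => ?_) e3
  rw [Set.mem_ofPred_eq, Classical.not_imp] at hg
  exact hg

/-- The product of two Householder reflections, as an element of `SO(2n+1)`. -/
def householderPair (a b : CoordIdx n → ℝ) (ha : a ≠ 0) (hb : b ≠ 0) : SOdd n :=
  ⟨householder a * householder b, by
    rw [mem_iff, Matrix.transpose_mul, householder_transpose, householder_transpose,
      Matrix.mul_assoc, ← Matrix.mul_assoc (householder a), householder_mul_self, Matrix.one_mul,
      householder_mul_self, Matrix.det_mul, det_householder ha, det_householder hb]
    norm_num⟩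

theorem householderPair_self (a : CoordIdx n → ℝ) (ha : a ≠ 0) :
    householderPair a a ha ha = 1 :=
  Subtype.ext (householder_mul_self a)

section

variable {f : Matrix (CoordIdx n) (CoordIdx n) ℝ → ℂ}

/-- The line from `b` to `a` gives an analytic curve of reflection pairs from `1` (at `t = 0`) to
the given pair (at `t = 1`). The line meets `0` only if `a` and `b` are parallel, and then the pair
is itself `1`. -/
theorem ae_householderPair_mul_mem (hf : AnalyticAlongCurves f) (hfc : Continuous f)
    (a b : CoordIdx n → ℝ) (ha : a ≠ 0) (hb : b ≠ 0) :
    ∀ᵐ g ∂(haar n), f g.1 = 0 → f (householderPair a b ha hb * g).1 = 0 := by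
  by_cases hab : ∃ t : ℝ, b + t • (a - b) = 0
  · obtain ⟨t, ht⟩ := hab
    have hpar : ∃ r : ℝ, a = r • b := by
      have ht0 : t ≠ 0 := by
        rintro rfl
        exact hb (by simpa using ht)
      refine ⟨(t - 1) / t, ?_⟩
      ext i
      have := congrFun ht i
      simp at this ⊢
      field_simp
      linarith
    obtain ⟨r, rfl⟩ := hpar
    have hr : r ≠ 0 := by
      rintro rfl
      exact ha (by simp)
    have : householder (r • b) = householder b := by
      have h : b ⬝ᵥ b ≠ 0 := fun h => hb (dotProduct_self_eq_zero.1 h)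
      ext i j
      simp [householder_apply]
      field_simp
    have h1 : householderPair (r • b) b ha hb = 1 :=
      Subtype.ext (by simp [householderPair, this, householder_mul_self])
    simp [h1]
  · push Not at hab
    let c : ℝ → SOdd n := fun t => householderPair (b + t • (a - b)) b (hab t) hb
    have hcan : ∀ i j, AnalyticOnNhd ℝ (fun t : ℝ => householder (b + t • (a - b)) i j) Set.univ := by
      intro i j t _
      have hlin : ∀ k, AnalyticAt ℝ (fun t : ℝ => (b + t • (a - b)) k) t := by
        intro k
        simp only [Pi.add_apply, Pi.smul_apply, smul_eq_mul]
        fun_prop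
      simp only [householder_apply]
      refine analyticAt_const.sub (((analyticAt_const).div ?_ ?_).mul ((hlin i).mul (hlin j)))
      · simp only [dotProduct]
        exact Finset.analyticAt_fun_sum _ fun k _ => (hlin k).mul (hlin k)
      · exact fun h => hab t (dotProduct_self_eq_zero.1 h)
    have hcc : Continuous c := by
      refine Continuous.subtype_mk ?_ _
      refine Continuous.matrix_mul ?_ continuous_const
      refine continuous_matrix fun i j => ?_
      exact continuousOn_univ.1 (hcan i j).continuousOn
    have key := ae_forall_curve_mul_mem (A := {g : SOdd n | f g.1 = 0})
      (isClosed_eq (hfc.comp continuous_subtype_val) continuous_const) hcc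
      (by simpa [c] using householderPair_self b hb) (fun g => ?_)
    · filter_upwards [key] with g hg h
      simpa [c] using hg h 1
    · by_cases h : ∀ t, c t * g ∈ {g : SOdd n | f g.1 = 0}
      · exact Or.inl h
      · push Not at h
        obtain ⟨t, ht⟩ := h
        refine Or.inr (AnalyticOnNhd.ae_ne_zero (hf (fun t => (c t * g).1) ?_) ht)
        intro i j
        have : (fun t : ℝ => (c t * g).1 i j) = fun t : ℝ => ∑ k, ∑ l,
            householder (b + t • (a - b)) i l * householder b l k * g.1 k j := by
          ext t
          change (householder (b + t • (a - b)) * householder b * g.1) i j = _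
          simp only [Matrix.mul_apply, Finset.sum_mul]
        rw [this]
        intro t _
        refine Finset.analyticAt_fun_sum _ fun k _ => Finset.analyticAt_fun_sum _ fun l _ => ?_
        exact ((hcan i l t trivial).mul analyticAt_const).mul analyticAt_const

/-- Reflections are peeled off in pairs, since a single one leaves `SO`. The exceptional null set of
the leading pair `p` is pulled back along `g ↦ p⁻¹ * h * g`, which preserves Haar measure. -/
theorem ae_list_householder_mul_mem (hf : AnalyticAlongCurves f) (hfc : Continuous f) :
    ∀ (k : ℕ) (l : List (CoordIdx n → ℝ)), l.length = 2 * k → (∀ w ∈ l, w ≠ 0) →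
      ∀ h : SOdd n, h.1 = (l.map householder).prod →
        ∀ᵐ g ∂(haar n), f g.1 = 0 → f (h * g).1 = 0
  | 0, l, hl, _, h, hh => by
    obtain rfl : l = [] := List.length_eq_zero_iff.1 (by simpa using hl)
    obtain rfl : h = 1 := Subtype.ext (by simpa using hh)
    simp
  | k + 1, [], hl, _, h, hh => by simp at hl
  | k + 1, [a], hl, _, h, hh => by simp at hl; omega
  | k + 1, a :: b :: l, hl, hw, h, hh => by
    have ha : a ≠ 0 := hw a (by simp)
    have hb : b ≠ 0 := hw b (by simp)
    set p := householderPair a b ha hb with hp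
    have ih := ae_list_householder_mul_mem hf hfc k l (by simp at hl; omega)
      (fun w hwl => hw w (by simp [hwl])) (p⁻¹ * h) (by
        have e : h.1 = p.1 * (l.map householder).prod := by
          rw [hh, hp]
          simp [householderPair, Matrix.mul_assoc]
        have e2 : (p⁻¹ * h).1 = (p⁻¹).1 * h.1 := rfl
        rw [e2, e, ← Matrix.mul_assoc, coe_inv, transpose_mul_self, Matrix.one_mul])
    have h2 := (measurePreserving_mul_left (haar n) (p⁻¹ * h)).quasiMeasurePreserving.ae
      (ae_householderPair_mul_mem hf hfc a b ha hb)
    filter_upwards [ih, h2] with g h3 h4 h5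
    have := h4 (h3 h5)
    rwa [← hp, ← mul_assoc, mul_inv_cancel_left] at this

/-- Determinant `1` makes the number of reflections even. -/
theorem ae_mul_mem (hf : AnalyticAlongCurves f) (hfc : Continuous f) (h : SOdd n) :
    ∀ᵐ g ∂(haar n), f g.1 = 0 → f (h * g).1 = 0 := by
  obtain ⟨l, hl, hM⟩ := exists_list_householder h.1 h.transpose_mul_self
  have hdet : ∀ l : List (CoordIdx n → ℝ), (∀ w ∈ l, w ≠ 0) →
      (l.map householder).prod.det = (-1) ^ l.length := by
    intro l hl
    induction l with
    | nil => simp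
    | cons a l ih =>
      rw [List.map_cons, List.prod_cons, Matrix.det_mul, ih fun w hw => hl w (by simp [hw]),
        det_householder (hl a (by simp)), List.length_cons, pow_succ]
      ring
  have h1 : (-1 : ℝ) ^ l.length = 1 := by
    rw [← hdet l hl, ← hM]
    exact ((mem_iff _).1 h.2).2
  have heven : Even l.length := by
    by_contra ho
    rw [Nat.not_even_iff_odd] at ho
    rw [ho.neg_one_pow] at h1
    norm_num at h1
  obtain ⟨k, hk⟩ := heven
  exact ae_list_householder_mul_mem hf hfc k l (by omega) hl h hM

/-- The zero set of an analytic function that does not vanish identically is a null set. -/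
theorem haar_zeros_eq_zero (hf : AnalyticAlongCurves f) (hfc : Continuous f) (g₀ : SOdd n)
    (hg₀ : f g₀.1 ≠ 0) : haar n {g | f g.1 = 0} = 0 := by
  by_contra hne
  have hA : IsClosed {g : SOdd n | f g.1 = 0} :=
    isClosed_eq (hfc.comp continuous_subtype_val) continuous_const
  have hB : MeasurableSet {p : SOdd n × SOdd n | f p.2.1 = 0 → f (p.1 * p.2).1 = 0} := by
    have h1 : MeasurableSet {p : SOdd n × SOdd n | f p.2.1 = 0} :=
      (hA.preimage continuous_snd).measurableSet
    have h2 : MeasurableSet {p : SOdd n × SOdd n | f (p.1 * p.2).1 = 0} :=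
      (hA.preimage (continuous_fst.mul continuous_snd)).measurableSet
    exact h1.imp h2
  have h1 : ∀ᵐ p ∂((haar n).prod (haar n)), f p.2.1 = 0 → f (p.1 * p.2).1 = 0 := by
    rw [Measure.ae_prod_iff_ae_ae hB]
    exact Filter.Eventually.of_forall fun h => ae_mul_mem hf hfc h
  -- The exceptional set of `g` depends on `h`. Fubini exchanges the two, yielding one zero `g` with
  -- `f (h * g) = 0` for almost all `h`; this contradicts openness of the complement near `h = g₀ *
  -- g⁻¹`.
  have h2 := Measure.ae_ae_comm hB |>.1 ((Measure.ae_prod_iff_ae_ae hB).1 h1)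
  obtain ⟨g, hg0, hg⟩ : ∃ g : SOdd n, f g.1 = 0 ∧ ∀ᵐ h ∂(haar n), f g.1 = 0 → f (h * g).1 = 0 := by
    by_contra hcon
    refine hne (measure_mono_null ?_ (ae_iff.1 h2))
    intro g hg h3
    exact hcon ⟨g, hg, h3⟩
  have hopen : IsOpen {h : SOdd n | f (h * g).1 ≠ 0} :=
    (hA.preimage (continuous_id.mul continuous_const)).isOpen_compl
  refine hopen.measure_ne_zero (haar n) ⟨g₀ * g⁻¹, by
    rwa [Set.mem_ofPred_eq, inv_mul_cancel_right]⟩ ?_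
  simpa [ae_iff, hg0] using hg

end

end SOdd

/-! ### Complex eigenspaces of real matrices -/

section Eigenspace

variable {m : Type*}

theorem map_ofReal_mul [Fintype m] (M N : Matrix m m ℝ) :
    (M * N).map Complex.ofReal = M.map Complex.ofReal * N.map Complex.ofReal :=
  Matrix.map_mul (f := Complex.ofRealHom)

theorem map_ofReal_one [DecidableEq m] : (1 : Matrix m m ℝ).map Complex.ofReal = 1 :=
  Matrix.map_one _ Complex.ofReal_zero Complex.ofReal_one

variable [Fintype m] [DecidableEq m]

/-- The eigenspace in `ℂ^m` of a real matrix. -/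
def complexEigenspace (M : Matrix m m ℝ) (α : ℂ) : Submodule ℂ (m → ℂ) :=
  Module.End.eigenspace (Matrix.toLin' (M.map Complex.ofReal)) α

theorem mem_complexEigenspace {M : Matrix m m ℝ} {α : ℂ} {w : m → ℂ} :
    w ∈ complexEigenspace M α ↔ M.map Complex.ofReal *ᵥ w = α • w := by
  rw [complexEigenspace, Module.End.mem_eigenspace_iff, Matrix.toLin'_apply]

theorem complexEigenspace_one_one : complexEigenspace (1 : Matrix m m ℝ) 1 = ⊤ := by
  refine eq_top_iff.2 fun w _ => mem_complexEigenspace.2 ?_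
  rw [map_ofReal_one, Matrix.one_mulVec, one_smul]

/-- `M * N` acts as `α * β` on the intersection of the two eigenspaces, whose dimension is bounded
below by the dimension formula. -/
theorem finrank_complexEigenspace_mul (M N : Matrix m m ℝ) (α β : ℂ) :
    Module.finrank ℂ (complexEigenspace M α) + Module.finrank ℂ (complexEigenspace N β) ≤
      Module.finrank ℂ (complexEigenspace (M * N) (α * β)) + Fintype.card m := by
  have hle : complexEigenspace M α ⊓ complexEigenspace N β ≤
      complexEigenspace (M * N) (α * β) := by
    rintro w ⟨h1, h2⟩
    have h1 := mem_complexEigenspace.1 h1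
    have h2 := mem_complexEigenspace.1 h2
    rw [mem_complexEigenspace, map_ofReal_mul, ← Matrix.mulVec_mulVec, h2, Matrix.mulVec_smul, h1,
      smul_smul, mul_comm]
  have h1 := Submodule.finrank_mono hle
  have h2 := Submodule.finrank_sup_add_finrank_inf_eq (complexEigenspace M α)
    (complexEigenspace N β)
  have h3 := Submodule.finrank_le (complexEigenspace M α ⊔ complexEigenspace N β)
  rw [Module.finrank_fintype_fun_eq_card] at h3
  omega

theorem finrank_complexEigenspace_conj (M P Q : Matrix m m ℝ) (hPQ : Q * P = 1) (α : ℂ) :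
    Module.finrank ℂ (complexEigenspace M α) ≤
      Module.finrank ℂ (complexEigenspace (P * M * Q) α) := by
  have hQP : Q.map Complex.ofReal * P.map Complex.ofReal = 1 := by
    rw [← map_ofReal_mul, hPQ, map_ofReal_one]
  have hmap : ∀ w ∈ complexEigenspace M α,
      Matrix.toLin' (P.map Complex.ofReal) w ∈ complexEigenspace (P * M * Q) α := by
    intro w hw
    rw [mem_complexEigenspace] at hw
    rw [mem_complexEigenspace, Matrix.toLin'_apply, Matrix.mulVec_mulVec, map_ofReal_mul,
      map_ofReal_mul, Matrix.mul_assoc, hQP, Matrix.mul_one, ← Matrix.mulVec_mulVec, hw,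
      Matrix.mulVec_smul]
  refine LinearMap.finrank_le_finrank_of_injective
    (f := (Matrix.toLin' (P.map Complex.ofReal)).restrict hmap) ?_
  intro w w' h
  have h := congrArg Subtype.val h
  simp only [LinearMap.coe_restrict_apply, Matrix.toLin'_apply] at h
  have h := congrArg (Q.map Complex.ofReal *ᵥ ·) h
  simp only [Matrix.mulVec_mulVec, hQP, Matrix.one_mulVec] at h
  exact Subtype.ext h

/-- Restricted to the coordinates `e k`, the vectors `b j` become the standard basis, so they are
independent. -/
theorem card_le_finrank_complexEigenspace {M : Matrix m m ℝ} {α : ℂ} {J : Type*} [Finite J]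
    (b : J → m → ℂ) (e : J → m) (hb : ∀ j, b j ∈ complexEigenspace M α)
    (h1 : ∀ j, b j (e j) = 1) (h0 : ∀ j k, j ≠ k → b j (e k) = 0) :
    Nat.card J ≤ Module.finrank ℂ (complexEigenspace M α) := by
  classical
  have := Fintype.ofFinite J
  have hli : LinearIndependent ℂ fun j => (⟨b j, hb j⟩ : complexEigenspace M α) := by
    refine LinearIndependent.of_comp
      ((LinearMap.funLeft ℂ ℂ e).comp (complexEigenspace M α).subtype) ?_
    convert (Pi.basisFun ℂ J).linearIndependent using 1
    ext j k
    by_cases hjk : j = k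
    · subst hjk
      simp [h1]
    · simp [h0 j k hjk, Ne.symm hjk]
  rw [Nat.card_eq_fintype_card]
  exact hli.fintype_card_le_finrank

end Eigenspace

/-! ### Generic multiplicities -/

section Generic

variable {m : Type*}

theorem analyticAlongCurves_const (c : ℂ) : AnalyticAlongCurves fun _ : Matrix m m ℝ => c :=
  fun _ _ _ _ => analyticAt_const

theorem analyticAlongCurves_entry_sub (i j : m) (c : ℂ) :
    AnalyticAlongCurves fun M : Matrix m m ℝ => (M i j : ℂ) - c := fun _ hM t _ =>
  ((Complex.ofRealCLM.analyticAt _).comp (hM i j t trivial)).sub analyticAt_const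

theorem analyticAlongCurves_det [Fintype m] [DecidableEq m]
    {F : Matrix m m ℝ → Matrix m m ℂ} (hF : ∀ i j, AnalyticAlongCurves fun M => F M i j) :
    AnalyticAlongCurves fun M => (F M).det := by
  intro M hM t _
  simp only [Matrix.det_apply']
  refine Finset.analyticAt_fun_sum _ fun σ _ => analyticAt_const.mul ?_
  exact Finset.analyticAt_fun_prod _ fun i _ => hF _ _ M hM t trivial

end Generic

namespace SOdd

variable {n : ℕ}

/-- Almost no element has the eigenvalue `α ≠ 1`. -/
theorem haar_eigenvalue_eq_zero {α : ℂ} (hα : α ≠ 1) :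
    haar n {g | 1 ≤ Module.finrank ℂ (complexEigenspace g.1 α)} = 0 := by
  -- The analytic function is `det (M - α)`; at the identity it is a power of `1 - α`.
  let F : Matrix (CoordIdx n) (CoordIdx n) ℝ → Matrix (CoordIdx n) (CoordIdx n) ℂ :=
    fun M => M.map Complex.ofReal - α • 1
  have hF : ∀ i j, AnalyticAlongCurves fun M => F M i j := fun i j => by
    simpa [F] using analyticAlongCurves_entry_sub i j (α * (1 : Matrix _ _ ℂ) i j)
  have hFc : Continuous fun M => (F M).det :=
    ((continuous_id.matrix_map Complex.continuous_ofReal).sub continuous_const).matrix_det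
  refine measure_mono_null (fun g hg => ?_)
    (haar_zeros_eq_zero (analyticAlongCurves_det hF) hFc 1 ?_)
  · obtain ⟨w, hw, hw0⟩ := Submodule.exists_mem_ne_zero_of_ne_bot
      (Submodule.one_le_finrank_iff.1 hg)
    rw [mem_complexEigenspace] at hw
    refine Matrix.exists_mulVec_eq_zero_iff.1 ⟨w, hw0, ?_⟩
    rw [Matrix.sub_mulVec, hw, Matrix.smul_mulVec, Matrix.one_mulVec, sub_self]
  · have : F (1 : SOdd n).1 = (1 - α) • 1 := by
      simp only [F]
      rw [OneMemClass.coe_one, map_ofReal_one, sub_smul, one_smul]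
    rw [this, Matrix.det_smul, Matrix.det_one, mul_one]
    exact pow_ne_zero _ (sub_ne_zero.2 hα.symm)

/-- The element `diag(-1, …, -1, 1)`. -/
def negPairs (n : ℕ) : SOdd n :=
  ⟨Matrix.diagonal (Sum.elim (fun _ => -1) fun _ => 1), by
    rw [mem_iff, Matrix.diagonal_transpose, Matrix.diagonal_mul_diagonal, Matrix.det_diagonal]
    constructor
    · rw [← Matrix.diagonal_one]
      congr 1
      ext i
      rcases i with i | i <;> simp
    · simp⟩

/-- For almost all elements the eigenvalue `1` is simple. -/
theorem haar_two_le_finrank_eigenspace_one :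
    haar n {g | 2 ≤ Module.finrank ℂ (complexEigenspace g.1 1)} = 0 := by
  let r : CoordIdx n := Sum.inr ()
  -- An eigenspace of dimension two contains a nonzero vector with vanishing last coordinate.
  -- Replacing the last row of `M - 1` by that coordinate functional then gives a singular matrix,
  -- whereas at `negPairs n` it becomes `diag(-2, …, -2, 1)`.
  let F : Matrix (CoordIdx n) (CoordIdx n) ℝ → Matrix (CoordIdx n) (CoordIdx n) ℂ :=
    fun M => (M.map Complex.ofReal - 1).updateRow r (Pi.single r 1)
  have hF : ∀ i j, AnalyticAlongCurves fun M => F M i j := fun i j => by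
    by_cases hi : i = r
    · simpa [F, hi] using analyticAlongCurves_const _
    · simpa [F, Matrix.updateRow_ne hi] using
        analyticAlongCurves_entry_sub i j ((1 : Matrix _ _ ℂ) i j)
  have hFc : Continuous fun M => (F M).det :=
    (((continuous_id.matrix_map Complex.continuous_ofReal).sub continuous_const).matrix_updateRow r
      continuous_const).matrix_det
  refine measure_mono_null (fun g hg => ?_)
    (haar_zeros_eq_zero (analyticAlongCurves_det hF) hFc (negPairs n) ?_)
  · obtain ⟨w, hw, hw0⟩ := Submodule.exists_mem_ne_zero_of_ne_bot
      (LinearMap.ker_ne_bot_of_finrank_lt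
        (f := (LinearMap.proj r).comp (complexEigenspace g.1 1).subtype)
        (by rw [Module.finrank_self]; exact hg))
    have hwr : w.1 r = 0 := hw
    have hwe := mem_complexEigenspace.1 w.2
    refine Matrix.exists_mulVec_eq_zero_iff.1 ⟨w.1, fun h => hw0 (Subtype.ext h), ?_⟩
    ext i
    by_cases hi : i = r
    · simp [F, hi, Matrix.mulVec, hwr]
    · have h2 : ((g.1.map Complex.ofReal - 1) *ᵥ w.1) i = 0 := by
        rw [Matrix.sub_mulVec, hwe, Matrix.one_mulVec, one_smul, sub_self, Pi.zero_apply]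
      simpa [F, Matrix.mulVec, Matrix.updateRow_ne hi] using h2
  · have : F (negPairs n).1 = Matrix.diagonal (Sum.elim (fun _ => -2) fun _ => 1) := by
      ext i j
      simp only [F]
      rcases i with i | i
      · rw [Matrix.updateRow_ne (show (Sum.inl i : CoordIdx n) ≠ r by simp [r])]
        by_cases hij : (Sum.inl i : CoordIdx n) = j
        · subst hij
          simp [negPairs]
          norm_num
        · simp [negPairs, Matrix.diagonal_apply_ne _ hij, Matrix.one_apply_ne hij]
      · rw [show (Sum.inr i : CoordIdx n) = r from rfl, Matrix.updateRow_self]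
        by_cases hij : r = j
        · subst hij
          simp [r]
        · rw [Matrix.diagonal_apply_ne _ hij, Pi.single_eq_of_ne (Ne.symm hij)]
    rw [this, Matrix.det_diagonal]
    refine Finset.prod_ne_zero_iff.2 fun i _ => ?_
    rcases i with i | i <;> simp

end SOdd

/-! ### Support of the convolution -/

namespace TorusB

variable {n : ℕ}

instance (x : TorusB n) : IsProbabilityMeasure x.orbitalMeasure :=
  Measure.isProbabilityMeasure_map
    (by fun_prop : Continuous fun g : SOdd n => g * x.toSO * g⁻¹).aemeasurable

theorem convOrbital_succ {L : ℕ} (x : Fin (L + 1) → TorusB n) :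
    convOrbital x = (x 0).orbitalMeasure.mconv (convOrbital fun i => x i.succ) := by
  simp [convOrbital, List.ofFn_succ]

theorem isProbabilityMeasure_convOrbital {L : ℕ} (x : Fin L → TorusB n) :
    IsProbabilityMeasure (convOrbital x) := by
  induction L with
  | zero =>
    simp only [convOrbital, List.ofFn_zero, List.foldr_nil]
    infer_instance
  | succ L ih =>
    rw [convOrbital_succ]
    have := ih fun i => x i.succ
    infer_instance

theorem orbitalMeasure_compl_range (x : TorusB n) :
    x.orbitalMeasure (Set.range fun g : SOdd n => g * x.toSO * g⁻¹)ᶜ = 0 := by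
  have hc : Continuous fun g : SOdd n => g * x.toSO * g⁻¹ := by fun_prop
  rw [orbitalMeasure, Measure.map_apply hc.measurable
    (isCompact_range hc).isClosed.measurableSet.compl]
  convert measure_empty (μ := SOdd.haar n)
  ext g
  simp

/-- Compactness makes the product set closed, hence measurable; a pair whose product lies outside it
has a factor outside `K` or `K'`. -/
theorem mconv_compl_mul_eq_zero {μ ν : Measure (SOdd n)} [SFinite μ] [SFinite ν]
    {K K' : Set (SOdd n)} (hK : IsCompact K) (hK' : IsCompact K') (hμ : μ Kᶜ = 0)
    (hν : ν K'ᶜ = 0) : (μ.mconv ν) ((fun p : SOdd n × SOdd n => p.1 * p.2) '' K ×ˢ K')ᶜ = 0 := by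
  rw [Measure.mconv, Measure.map_apply continuous_mul.measurable
    ((hK.prod hK').image continuous_mul).isClosed.measurableSet.compl]
  have hsub : (fun p : SOdd n × SOdd n => p.1 * p.2) ⁻¹'
      ((fun p : SOdd n × SOdd n => p.1 * p.2) '' K ×ˢ K')ᶜ ⊆
      Kᶜ ×ˢ Set.univ ∪ Set.univ ×ˢ K'ᶜ := by
    intro p hp
    by_contra hcon
    simp only [Set.mem_union, Set.mem_prod, Set.mem_compl_iff, Set.mem_univ, and_true, true_and,
      not_or, not_not] at hcon
    exact hp ⟨p, hcon, rfl⟩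
  refine measure_mono_null hsub (measure_union_null ?_ ?_)
  · rw [Measure.prod_prod, hμ, zero_mul]
  · rw [Measure.prod_prod, hν, mul_zero]

/-- The convolution is carried by elements that have the eigenvalue `∏ α_i` with at least the
multiplicity forced by the intersection of eigenspaces. -/
theorem exists_isCompact_convOrbital {L : ℕ} (x : Fin L → TorusB n) (α : Fin L → ℂ) :
    ∃ K : Set (SOdd n), IsCompact K ∧ convOrbital x Kᶜ = 0 ∧ ∀ y ∈ K,
      ∑ i, Module.finrank ℂ (complexEigenspace (x i).toSO.1 (α i)) + (2 * n + 1) ≤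
        Module.finrank ℂ (complexEigenspace y.1 (∏ i, α i)) + (2 * n + 1) * L := by
  induction L with
  | zero =>
    -- The empty convolution sits at the identity, whose eigenvalue `1`, the empty product, has full
    -- multiplicity `2n+1`.
    refine ⟨{1}, isCompact_singleton, by simp [convOrbital], ?_⟩
    rintro y rfl
    rw [Finset.univ_eq_empty, Finset.prod_empty, OneMemClass.coe_one, complexEigenspace_one_one,
      finrank_top, Module.finrank_fintype_fun_eq_card, card_coordIdx]
    simp
  | succ L ih =>
    obtain ⟨K, hK, hK0, hKd⟩ := ih (fun i => x i.succ) fun i => α i.succ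
    have hc : Continuous fun g : SOdd n => g * (x 0).toSO * g⁻¹ := by fun_prop
    have := isProbabilityMeasure_convOrbital fun i => x i.succ
    refine ⟨_, ((isCompact_range hc).prod hK).image continuous_mul, ?_, ?_⟩
    · rw [convOrbital_succ]
      exact mconv_compl_mul_eq_zero (isCompact_range hc) hK (orbitalMeasure_compl_range _) hK0
    · rintro _ ⟨⟨_, y⟩, ⟨⟨g, rfl⟩, hy⟩, rfl⟩
      have h1 := hKd y hy
      have h2 := finrank_complexEigenspace_conj (x 0).toSO.1 g.1 (g⁻¹).1 g.transpose_mul_self (α 0)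
      have h3 := finrank_complexEigenspace_mul (g * (x 0).toSO * g⁻¹).1 y.1 (α 0)
        (∏ i : Fin L, α i.succ)
      rw [card_coordIdx] at h3
      rw [Fin.sum_univ_succ, Fin.prod_univ_succ]
      have h4 : (g * (x 0).toSO * g⁻¹).1 = g.1 * (x 0).toSO.1 * (g⁻¹).1 := rfl
      have h5 : (g * (x 0).toSO * g⁻¹ * y).1 = (g * (x 0).toSO * g⁻¹).1 * y.1 := rfl
      rw [h5]
      rw [← h4] at h2
      rw [mul_add]
      omega

/-- Otherwise `K ⊆ Z`, and a probability measure would vanish on both `K` and its complement. -/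
theorem IsAbsCont.exists_notMem {L : ℕ} {x : Fin L → TorusB n} (hx : IsAbsCont x)
    {K Z : Set (SOdd n)} (hK : convOrbital x Kᶜ = 0) (hZ : SOdd.haar n Z = 0) :
    ∃ y ∈ K, y ∉ Z := by
  by_contra! hcon
  have := isProbabilityMeasure_convOrbital x
  have h1 : convOrbital x Set.univ = 0 := by
    refine measure_mono_null (fun y _ => ?_) (measure_union_null hK (hx hZ))
    by_cases hy : y ∈ K
    · exact Or.inr (hcon y hy)
    · exact Or.inl hy
  simp at h1

/-- The dimension bound when `∏ α_i ≠ 1`. -/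
theorem IsAbsCont.sum_finrank_le {L : ℕ} {x : Fin L → TorusB n} (hx : IsAbsCont x)
    (α : Fin L → ℂ) (hα : ∏ i, α i ≠ 1) :
    ∑ i, Module.finrank ℂ (complexEigenspace (x i).toSO.1 (α i)) + (2 * n + 1) ≤
      (2 * n + 1) * L := by
  obtain ⟨K, -, hK, hKd⟩ := exists_isCompact_convOrbital x α
  obtain ⟨y, hy, hyZ⟩ := hx.exists_notMem hK (SOdd.haar_eigenvalue_eq_zero hα)
  have h1 := hKd y hy
  rw [Set.mem_ofPred_eq] at hyZ
  omega

/-- The dimension bound when `∏ α_i = 1`. -/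
theorem IsAbsCont.sum_finrank_le_add_one {L : ℕ} {x : Fin L → TorusB n} (hx : IsAbsCont x)
    (α : Fin L → ℂ) (hα : ∏ i, α i = 1) :
    ∑ i, Module.finrank ℂ (complexEigenspace (x i).toSO.1 (α i)) + (2 * n + 1) ≤
      (2 * n + 1) * L + 1 := by
  obtain ⟨K, -, hK, hKd⟩ := exists_isCompact_convOrbital x α
  obtain ⟨y, hy, hyZ⟩ := hx.exists_notMem hK SOdd.haar_two_le_finrank_eigenspace_one
  have h1 := hKd y hy
  rw [Set.mem_ofPred_eq] at hyZ
  rw [hα] at h1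
  omega

/-! ### Eigenspaces of torus elements -/

/-- The eigenvector equation decouples into one system per block, against which explicit
eigenvectors are checked below. -/
theorem mem_complexEigenspace_toSO {x : TorusB n} {α : ℂ} {w : CoordIdx n → ℂ} :
    w ∈ complexEigenspace x.toSO.1 α ↔
      (∀ j, ((x j : ℂ).re * w (.inl (0, j)) - (x j : ℂ).im * w (.inl (1, j)) =
          α * w (.inl (0, j))) ∧
        ((x j : ℂ).im * w (.inl (0, j)) + (x j : ℂ).re * w (.inl (1, j)) =
          α * w (.inl (1, j)))) ∧ w (.inr ()) = α * w (.inr ()) := by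
  rw [mem_complexEigenspace, funext_iff]
  have h0 : ∀ j, (x.toSO.1.map Complex.ofReal *ᵥ w) (.inl (0, j)) =
      (x j : ℂ).re * w (.inl (0, j)) - (x j : ℂ).im * w (.inl (1, j)) := by
    intro j
    simp [toSO, toMatrix, Matrix.mulVec, dotProduct, Fintype.sum_prod_type,
      Matrix.blockDiagonal_apply, rotBlock, apply_ite, ite_mul, sub_eq_add_neg]
  have h1 : ∀ j, (x.toSO.1.map Complex.ofReal *ᵥ w) (.inl (1, j)) =
      (x j : ℂ).im * w (.inl (0, j)) + (x j : ℂ).re * w (.inl (1, j)) := by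
    intro j
    simp [toSO, toMatrix, Matrix.mulVec, dotProduct, Fintype.sum_prod_type,
      Matrix.blockDiagonal_apply, rotBlock, apply_ite, ite_mul]
  have h2 : (x.toSO.1.map Complex.ofReal *ᵥ w) (.inr ()) = w (.inr ()) := by
    simp [toSO, toMatrix, Matrix.mulVec, dotProduct]
  constructor
  · intro h
    refine ⟨fun j => ⟨?_, ?_⟩, ?_⟩
    · rw [← h0, h]; rfl
    · rw [← h1, h]; rfl
    · exact h2.symm.trans (h _)
  · rintro ⟨h, h'⟩ (⟨k, j⟩ | _)
    · fin_cases k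
      · exact (h0 j).trans (h j).1
      · exact (h1 j).trans (h j).2
    · exact h2.trans h'

/-- Each entry `1` supplies two coordinate vectors, and the final `1 × 1` block supplies the extra
one. -/
theorem two_mul_u_add_one_le_finrank (x : TorusB n) :
    2 * x.u + 1 ≤ Module.finrank ℂ (complexEigenspace x.toSO.1 1) := by
  let e : (Fin 2 × {j // x j = 1}) ⊕ Unit → CoordIdx n := Sum.map (Prod.map id Subtype.val) id
  have he : Function.Injective e :=
    (Function.injective_id.prodMap Subtype.val_injective).sumMap Function.injective_id
  have := card_le_finrank_complexEigenspace (M := x.toSO.1) (α := 1)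
    (fun i => Pi.single (e i) (1 : ℂ)) e ?_ (by simp)
    (fun j k hjk => Pi.single_eq_of_ne (fun h => hjk (he h.symm)) _)
  · simpa [Nat.card_sum, Nat.card_prod, u] using this
  · intro i
    rw [mem_complexEigenspace_toSO]
    refine ⟨fun j => ?_, by simp⟩
    by_cases hj : x j = 1
    · simp [hj]
    · have hne : ∀ k, (Pi.single (e i) (1 : ℂ) : CoordIdx n → ℂ) (.inl (k, j)) = 0 := by
        intro k
        refine Pi.single_eq_of_ne ?_ _
        rcases i with ⟨k', j', hj'⟩ | i
        · rintro h
          simp [e] at h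
          exact hj (h.2 ▸ hj')
        · simp [e]
      simp [hne]

theorem two_mul_v_le_finrank (x : TorusB n) :
    2 * x.v ≤ Module.finrank ℂ (complexEigenspace x.toSO.1 (-1)) := by
  let e : Fin 2 × {j // (x j : ℂ) = -1} → CoordIdx n := fun p => Sum.inl (p.1, p.2.1)
  have he : Function.Injective e :=
    Sum.inl_injective.comp (Function.injective_id.prodMap Subtype.val_injective)
  have := card_le_finrank_complexEigenspace (M := x.toSO.1) (α := -1)
    (fun i => Pi.single (e i) (1 : ℂ)) e ?_ (by simp)
    (fun j k hjk => Pi.single_eq_of_ne (fun h => hjk (he h.symm)) _)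
  · simpa [Nat.card_prod, v] using this
  · intro i
    rw [mem_complexEigenspace_toSO]
    refine ⟨fun j => ?_, by simp [e]⟩
    by_cases hj : (x j : ℂ) = -1
    · simp [hj]
    · have hne : ∀ k, (Pi.single (e i) (1 : ℂ) : CoordIdx n → ℂ) (.inl (k, j)) = 0 := by
        intro k
        refine Pi.single_eq_of_ne ?_ _
        rcases i with ⟨k', j', hj'⟩
        rintro h
        simp [e] at h
        exact hj (h.2 ▸ hj')
      simp [hne]

/-- Each block of `z` or `z⁻¹` supplies one eigenvector for `z`: `(1, -i)` in the first case, `(1,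
i)` in the second. -/
theorem mult_le_finrank (x : TorusB n) (z : Circle) :
    x.mult z ≤ Module.finrank ℂ (complexEigenspace x.toSO.1 z) := by
  classical
  let J := {j // x j = z ∨ x j = z⁻¹}
  let c : J → ℂ := fun j => if x j.1 = z then -Complex.I else Complex.I
  let b : J → CoordIdx n → ℂ := fun j =>
    Pi.single (.inl (0, j.1)) 1 + Pi.single (.inl (1, j.1)) (c j)
  refine card_le_finrank_complexEigenspace (J := J) b (fun j => .inl (0, j.1)) ?_ ?_ ?_
  · intro j
    rw [mem_complexEigenspace_toSO]
    refine ⟨fun k => ?_, by simp [b]⟩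
    by_cases hk : k = j.1
    · subst hk
      have hb0 : b j (.inl (0, j.1)) = 1 := by simp [b]
      have hb1 : b j (.inl (1, j.1)) = c j := by simp [b]
      rw [hb0, hb1]
      by_cases hz : x j.1 = z
      · have hc : c j = -Complex.I := if_pos hz
        rw [hc, hz]
        constructor <;> apply Complex.ext <;> simp
      · have hc : c j = Complex.I := if_neg hz
        have hz' := j.2.resolve_left hz
        rw [hc, hz', Circle.coe_inv_eq_conj]
        constructor <;> apply Complex.ext <;> simp
    · have hne : ∀ l, b j (.inl (l, k)) = 0 := by
        intro l
        simp [b, hk]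
      simp [hne]
  · intro j
    simp [b]
  · intro j k hjk
    have : k.1 ≠ j.1 := fun h => hjk (Subtype.ext h.symm)
    simp [b, this]

/-- Positivity excludes the empty supremum, so the maximum is attained at an entry. -/
theorem exists_s_eq_mult {x : TorusB n} (hs : 0 < x.s) :
    ∃ z : Circle, x.s = x.mult z ∧ (z : ℂ) ≠ 1 ∧ (z : ℂ) ≠ -1 := by
  classical
  rw [s] at hs ⊢
  obtain ⟨j₀, hj₀, -⟩ := Finset.lt_sup_iff.1 hs
  obtain ⟨j, hj, hjs⟩ := Finset.exists_mem_eq_sup _ ⟨j₀, hj₀⟩ fun j => x.mult (x j)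
  rw [Finset.mem_filter] at hj
  exact ⟨x j, hjs, fun h => hj.2.1 (Circle.ext h), hj.2.2⟩

end TorusB

/-! ### Eligibility -/

namespace TorusB

variable {n : ℕ}

/-- An eigenvalue of multiplicity at least `S_x`. -/
theorem exists_bigS_le_finrank (x : TorusB n) (p : ℕ) :
    ∃ α : ℂ, x.bigS p ≤ Module.finrank ℂ (complexEigenspace x.toSO.1 α) ∧
      (x.dominantType = .B → α = 1) ∧ (x.dominantType = .D → α = -1) ∧
      (x.dominantType = .S → α ≠ 1 ∧ α ≠ -1) ∧
      (x.dominantType = .BD → α = if p = 1 then 1 else -1) := by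
  cases h : x.dominantType with
  | B => exact ⟨1, by simpa [bigS, h] using x.two_mul_u_add_one_le_finrank, by simp⟩
  | D => exact ⟨-1, by simpa [bigS, h] using x.two_mul_v_le_finrank, by simp⟩
  -- With `p` the parity of the tuple, this sign is opposite to the product of the signs of the type
  -- `D` entries.
  | BD =>
    by_cases hp : p = 1
    · exact ⟨1, by simpa [bigS, h, hp] using x.two_mul_u_add_one_le_finrank, by simp [hp]⟩
    · exact ⟨-1, by simpa [bigS, h, hp] using x.two_mul_v_le_finrank, by simp [hp]⟩
  | S =>
    have hS := (x.dominantType_eq_iff .S).1 h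
    obtain ⟨z, hz, hz1⟩ := exists_s_eq_mult (x := x) (by have := hS.1; omega)
    refine ⟨z, ?_, by simpa using hz1⟩
    simp only [bigS, h, hz]
    exact x.mult_le_finrank z

theorem prod_sign {L : ℕ} (x : Fin L → TorusB n) [DecidablePred fun i => (x i).dominantType = .D] :
    ∏ i, (if (x i).dominantType = .D then (-1 : ℂ) else 1) = if parity x = 1 then -1 else 1 := by
  rw [Finset.prod_ite, Finset.prod_const, Finset.prod_const_one, mul_one, parity,
    Nat.card_eq_fintype_card, Fintype.card_subtype]
  split_ifs with h h' h'
  · exact h.neg_one_pow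
  · exact absurd rfl h'
  · simp at h'
  · exact (Nat.not_odd_iff_even.1 h).neg_one_pow

theorem parity_eq_one_or_two {L : ℕ} (x : Fin L → TorusB n) : parity x = 1 ∨ parity x = 2 := by
  rw [parity]
  split_ifs <;> simp

end TorusB

end

theorem mainTheorem2 (n : ℕ) (hn : 1 ≤ n) (L : ℕ) (x : Fin L → TorusB n)
    (hx : TorusB.IsAbsCont x) : TorusB.Eligible x := by
  classical
  choose α hα hB hD hS hBD using fun i => (x i).exists_bigS_le_finrank (TorusB.parity x)
  have hsum := Finset.sum_le_sum fun i (_ : i ∈ Finset.univ) => hα i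
  have hp := TorusB.parity_eq_one_or_two x
  by_cases h2 : ∃ i j, i ≠ j ∧ ((x i).dominantType = .BD ∨ (x i).dominantType = .S) ∧
      ((x j).dominantType = .BD ∨ (x j).dominantType = .S)
  · exact Or.inl h2
  right
  by_cases h1 : ∃ j, (x j).dominantType = .BD ∨ (x j).dominantType = .S
  · obtain ⟨j, hj⟩ := h1
    have hother : ∀ i, i ≠ j → (x i).dominantType ≠ .BD ∧ (x i).dominantType ≠ .S := by
      intro i hij
      by_contra hcon
      exact h2 ⟨i, j, hij, by tauto, hj⟩
    have hαi : ∀ i, α i = (if (x i).dominantType = .D then (-1 : ℂ) else 1) *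
        if i = j then α j else 1 := by
      intro i
      by_cases hij : i = j
      · subst hij
        have : (x i).dominantType ≠ .D := by rintro h; simp [h] at hj
        simp [this]
      · have h3 := hother i hij
        cases h : (x i).dominantType <;> simp_all
    have hprod : ∏ i, α i = (if TorusB.parity x = 1 then -1 else 1) * α j := by
      rw [Finset.prod_congr rfl fun i _ => hαi i, Finset.prod_mul_distrib, TorusB.prod_sign,
        Finset.prod_ite_eq' Finset.univ j]
      simp
    -- For type `BD` the product is `-1`; for type `S` it is `α j` or `-α j`, and `α j` is neither
    -- `1` nor `-1`.
    have hne : ∏ i, α i ≠ 1 := by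
      rw [hprod]
      rcases hj with hj | hj
      · rw [hBD j hj]
        split_ifs <;> norm_num
      · have h3 := hS j hj
        split_ifs
        · intro h
          exact h3.2 (by rw [← h]; ring)
        · rw [one_mul]
          exact h3.1
    have hle : (∑ i, ((x i).bigS (TorusB.parity x) : ℤ)) ≤ (2 * n + 1) * ((L : ℤ) - 1) := by
      have h3 := hx.sum_finrank_le α hne
      zify at h3 hsum
      linarith
    rcases hj with hj | hj
    · refine Or.inr (Or.inl ⟨⟨j, hj, fun i hi => ?_⟩, fun i hi => ?_, hle⟩)
      · by_contra hij
        exact (hother i hij).1 hi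
      · by_cases hij : i = j
        · simp [← hij, hi] at hj
        · exact (hother i hij).2 hi
    · refine Or.inl ⟨⟨j, hj, fun i hi => ?_⟩, fun i hi => ?_, hle⟩
      · by_contra hij
        exact (hother i hij).2 hi
      · by_cases hij : i = j
        · simp [← hij, hi] at hj
        · exact (hother i hij).1 hi
  · push Not at h1
    refine Or.inr (Or.inr ⟨h1, ?_⟩)
    have hαi : ∀ i, α i = if (x i).dominantType = .D then (-1 : ℂ) else 1 := by
      intro i
      have h3 := h1 i
      cases h : (x i).dominantType <;> simp_all
    have hprod : ∏ i, α i = if TorusB.parity x = 1 then -1 else 1 := by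
      rw [Finset.prod_congr rfl fun i _ => hαi i, TorusB.prod_sign]
    -- Parity `1` gives product `-1` and the strict bound; parity `2` gives product `1`, where the
    -- generic multiplicity of at most one leaves room for one extra unit.
    rcases hp with hp | hp
    · have h3 := hx.sum_finrank_le α (by rw [hprod, if_pos hp]; norm_num)
      zify at h3 hsum
      rw [hp] at hsum ⊢
      push_cast
      linarith
    · have h3 := hx.sum_finrank_le_add_one α (by rw [hprod, if_neg (by omega)])
      zify at h3 hsum
      rw [hp] at hsum ⊢
      push_cast
      linarith
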